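/- Let $\mu$ be a probability measure on $\mathbb{R}$ all of whose moments exist, with $\int x\,d\mu(x)=0$ and $\int x^2\,d\mu(x)=1$. For every $N$ let $A_N=\frac1{\sqrt N}(a_{ij})_{i,j=1}^N$ be a corresponding real Wigner matrix, i.e. a random matrix (on some probability space, which may depend on $N$) such that $a_{ij}=a_{ji}$ for all $i,j$, the entries $\{a_{ij}\mid i\ge j\}$ are independent, and each $a_{ij}$ has distribution $\mu$. Let $\operatorname{tr}=\frac1N\operatorname{Tr}$ be the normalized trace. Then for every integer $m\ge 0$ the random variables $\operatorname{tr}(A_N^m)$ are integrable and $$\lim_{N\to\infty}\mathbb{E}\big[\operatorname{tr}(A_N^m)\big]=\frac1{2\pi}\int_{-2}^{2}x^m\sqrt{4-x^2}\,dx .$$ For a partition $\sigma$ of $[m]=\{1,\dots,m\}$ let $\mathcal{G}_\sigma$ be the graph whose vertices are the blocks of $\sigma$ and whose edges join, for each $r\in[m]$, the block of $r$ to the block of $r+1$ (with $m+1$ read as $1$); loops are kept and multiple edges are erased. Let $\mathcal{T}(m)$ be the set of partitions $\sigma$ of $[m]$ for which $\mathcal{G}_\sigma$ is a tree (connected, without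 cycles, in particular without loops) with exactly $\frac m2+1$ vertices. Then, for every $m\ge 1$, $$\lim_{N\to\infty}\mathbb{E}\big[\operatorname{tr}(A_N^m)\big]=\#\mathcal{T}(m),$$ and the following map is a bijection from $\mathcal{T}(m)$ onto the set $\mathcal{NC}_2(m)$ of non-crossing pairings of $[m]$ (partitions into blocks of size two without blocks $\{i,k\}$, $\{j,l\}$ such that $i<j<k<l$): to $\sigma$ one assigns the partition of $[m]$ in which $r$ and $s$ lie in the same block if and only if the $r$-th and $s$-th steps of the closed walk through the blocks of $1,2,\dots,m,1$ use the same edge of $\mathcal{G}_\sigma$. -/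

import Mathlib

open MeasureTheory ProbabilityTheory Filter Topology

/-- `A` is an `N × N` Wigner random matrix for the distribution `μ` on `ℝ`: `A = (a i j) / √N` with
`a` symmetric, the entries `a i j` with `j ≤ i` independent, and every entry distributed as `μ`. -/
def IsWignerMatrix {Ω : Type*} [MeasurableSpace Ω] (P : Measure Ω) (μ : Measure ℝ) {N : ℕ}
    (A : Ω → Matrix (Fin N) (Fin N) ℝ) : Prop :=
  ∃ a : Fin N → Fin N → Ω → ℝ,
    (∀ i j, a i j = a j i) ∧
    iIndepFun (fun p : {p : Fin N × Fin N // p.2 ≤ p.1} => a p.1.1 p.1.2) P ∧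
    (∀ i j, HasLaw (a i j) μ P) ∧
    ∀ ω i j, A ω i j = 1 / √(N : ℝ) * a i j ω

/-- The normalized trace `tr = (1/N) Tr`. -/
noncomputable def normTrace {N : ℕ} (A : Matrix (Fin N) (Fin N) ℝ) : ℝ :=
  1 / (N : ℝ) * A.trace

/-! A partition of `[m]` is given by the equivalence relation "lie in the same block", so it is a
`Setoid (Fin m)` and its blocks are the elements of the quotient. -/

/-- The edge of the graph of `σ` that joins the block of `r` to the block of `r + 1` (mod `m`).
It is the `r`-th step of the closed walk through the blocks of `1, 2, …, m, 1`. -/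
def stepEdge {m : ℕ} (σ : Setoid (Fin m)) (r : Fin m) : Sym2 (Quotient σ) :=
  s(Quotient.mk σ r, Quotient.mk σ (finRotate m r))

/-- The graph of `σ`: its vertices are the blocks of `σ` and its edges, loops included and multiple
edges erased, are the `stepEdge σ r`. -/
def partitionGraphEdges {m : ℕ} (σ : Setoid (Fin m)) : Set (Sym2 (Quotient σ)) :=
  Set.range (stepEdge σ)

/-- The graph of `σ` is a tree: it has no loops, and it is connected and acyclic. -/
def PartitionGraphIsTree {m : ℕ} (σ : Setoid (Fin m)) : Prop :=
  (∀ e ∈ partitionGraphEdges σ, ¬ e.IsDiag) ∧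
    (SimpleGraph.fromEdgeSet (partitionGraphEdges σ)).IsTree

/-- The partitions of `[m]` whose graph is a tree with `m / 2 + 1` vertices. -/
def treePartitions (m : ℕ) : Set (Setoid (Fin m)) :=
  {σ | PartitionGraphIsTree σ ∧ 2 * Nat.card (Quotient σ) = m + 2}

/-- The non-crossing pairings of `[m]`: all blocks have exactly two elements, and there are no
blocks `{i, k}`, `{j, l}` with `i < j < k < l`. -/
def nonCrossingPairings (m : ℕ) : Set (Setoid (Fin m)) :=
  {π | (∀ r, {s | π r s}.ncard = 2) ∧
    ¬ ∃ i j k l : Fin m, i < j ∧ j < k ∧ k < l ∧ π i k ∧ π j l}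

/-- The partition of the steps of the walk of `σ` in which two steps lie in the same block if and
only if they use the same edge. -/
def stepPairing {m : ℕ} (σ : Setoid (Fin m)) : Setoid (Fin m) :=
  Setoid.ker (stepEdge σ)

/-!
The expected trace is computed by the moment method. Expand `Tr (A ^ m)` as a sum over closed walks
`i 1, …, i m, i 1` in the index set and sort the walks by the partition `σ = ker i` of `[m]`. By
independence the expectation along a walk is the product, over the edges of the graph of `σ`, of the
moments of `μ` that belong to the multiplicities of the edges; it depends on `σ` only (`walkWeight`).
A partition with `k` blocks comes from `N (N - 1) ⋯ (N - k + 1)` walks, and the normalization is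
`N ^ (-(m + 2) / 2)`. As `μ` is centered, a contributing `σ` uses each edge at least twice, so it has
at most `m / 2` edges and, the graph being connected, at most `m / 2 + 1` blocks. Equality forces the
graph to be a tree, and then each edge is used exactly twice and the weight is `1`. Hence the limit
counts the tree partitions (`tendsto_summand`).

For the bijection, an edge of a tree cuts the vertices into two sides, and a step of the walk changes
sides exactly if it uses that edge. If each edge is used twice, the walk is on the far side of an edge
precisely between its two uses (`sameSide_iff`). This makes the step pairing non-crossing, and since
distinct vertices of a tree are separated by some edge, it lets one read off `σ` from the pairing
(`treePartitions_rel_iff`), which gives injectivity. Conversely, the partition of the times according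
to the set of arcs of a non-crossing pairing that are open at that time is a tree partition with the
given step pairing (`surjOn_stepPairing`).

Non-crossing pairings satisfy the Catalan recursion, by splitting off the arc of the first point
(`card_ncInvolution`), and the moments of the semicircle law satisfy the two-term recursion of the
Catalan numbers, by integration by parts (`semicircle_moment`).
-/

/-! ### Moments of the semicircle law -/

/-- The number of non-crossing pairings of `n` points on a line: a Catalan number if `n` is even,
zero if `n` is odd. -/
def aeratedCatalan (n : ℕ) : ℕ := if Even n then catalan (n / 2) else 0

lemma aeratedCatalan_two_mul (k : ℕ) : aeratedCatalan (2 * k) = catalan k := by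
  simp [aeratedCatalan]

lemma aeratedCatalan_of_odd {n : ℕ} (h : ¬ Even n) : aeratedCatalan n = 0 := by
  simp [aeratedCatalan, h]

/-- The two-term recursion of the Catalan numbers, shared by the semicircle moments. -/
lemma add_four_mul_aeratedCatalan (n : ℕ) :
    (n + 4) * aeratedCatalan (n + 2) = 4 * (n + 1) * aeratedCatalan n := by
  rcases Nat.even_or_odd' n with ⟨k, rfl | rfl⟩
  · rw [show 2 * k + 2 = 2 * (k + 1) by ring, aeratedCatalan_two_mul, aeratedCatalan_two_mul]
    have h1 := succ_mul_catalan_eq_centralBinom k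
    have h2 := succ_mul_catalan_eq_centralBinom (k + 1)
    have h3 := Nat.succ_mul_centralBinom_succ k
    rw [← h1, ← h2] at h3
    have : (k + 1) * ((k + 2) * catalan (k + 1)) = (k + 1) * (2 * (2 * k + 1) * catalan k) := by
      linarith
    have := Nat.eq_of_mul_eq_mul_left (Nat.succ_pos k) this
    linarith
  · rw [aeratedCatalan_of_odd (by simp [parity_simps]),
      aeratedCatalan_of_odd (by simp [parity_simps])]
    simp

/-- Integration by parts: on `(-2, 2)` the derivative of `p x * (4 - x ^ 2) ^ (3 / 2)` is
`(p' x * (4 - x ^ 2) - 3 * x * p x) * √(4 - x ^ 2)`, and the function vanishes at both ends. -/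
lemma integral_deriv_mul_semicircle {p p' : ℝ → ℝ} (hp : ∀ x, HasDerivAt p (p' x) x)
    (hc : Continuous p') :
    ∫ x in (-2 : ℝ)..2, (p' x * (4 - x ^ 2) - 3 * x * p x) * √(4 - x ^ 2) = 0 := by
  have hcp : Continuous p := continuous_iff_continuousAt.2 fun x => (hp x).continuousAt
  have := intervalIntegral.integral_eq_sub_of_hasDerivAt_of_le (a := -2) (b := 2) (by norm_num)
    (f := fun x => p x * (4 - x ^ 2) * √(4 - x ^ 2))
    (f' := fun x => (p' x * (4 - x ^ 2) - 3 * x * p x) * √(4 - x ^ 2))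
    (by fun_prop) ?_ (Continuous.intervalIntegrable (by fun_prop) _ _)
  · rw [this]; norm_num
  · intro x hx
    have hpos : 0 < 4 - x ^ 2 := by nlinarith [hx.1, hx.2]
    have hq : HasDerivAt (fun x : ℝ => 4 - x ^ 2) (-(2 * x)) x := by
      simpa using (hasDerivAt_pow 2 x).const_sub 4
    have hs := Real.sq_sqrt hpos.le
    have hs0 : √(4 - x ^ 2) ≠ 0 := (Real.sqrt_pos.2 hpos).ne'
    refine (((hp x).mul hq).mul (hq.sqrt hpos.ne')).congr_deriv ?_
    rw [Pi.mul_apply]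
    field_simp
    rw [hs]
    ring

lemma integral_semicircle_zero : ∫ x in (-2 : ℝ)..2, √(4 - x ^ 2) = 2 * Real.pi := by
  have h := intervalIntegral.mul_integral_comp_mul_left (a := -1) (b := 1)
    (f := fun x : ℝ => √(4 - x ^ 2)) (c := 2)
  have h2 : ∀ x : ℝ, √(4 - (2 * x) ^ 2) = 2 * √(1 - x ^ 2) := by
    intro x
    rw [show 4 - (2 * x) ^ 2 = 2 ^ 2 * (1 - x ^ 2) by ring, Real.sqrt_mul (by positivity),
      Real.sqrt_sq (by norm_num)]
  simp only [h2, intervalIntegral.integral_const_mul, integral_sqrt_one_sub_sq] at h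
  norm_num at h
  rw [← h]; ring

lemma integral_semicircle_one : ∫ x in (-2 : ℝ)..2, x * √(4 - x ^ 2) = 0 := by
  have h := integral_deriv_mul_semicircle (p := fun _ => 1) (p' := fun _ => 0)
    (fun x => hasDerivAt_const x 1) continuous_const
  have : ∀ x : ℝ, (0 * (4 - x ^ 2) - 3 * x * 1) * √(4 - x ^ 2) = (-3) * (x * √(4 - x ^ 2)) := by
    intro x; ring
  simp only [this, intervalIntegral.integral_const_mul] at h
  linarith

lemma integral_semicircle_add_two (n : ℕ) :
    (n + 4 : ℝ) * ∫ x in (-2 : ℝ)..2, x ^ (n + 2) * √(4 - x ^ 2) =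
      4 * (n + 1) * ∫ x in (-2 : ℝ)..2, x ^ n * √(4 - x ^ 2) := by
  have h := integral_deriv_mul_semicircle (p := fun x => x ^ (n + 1))
    (p' := fun x => (n + 1 : ℝ) * x ^ n)
    (fun x => by simpa using hasDerivAt_pow (n + 1) x) (by fun_prop)
  have : ∀ x : ℝ, ((n + 1) * x ^ n * (4 - x ^ 2) - 3 * x * x ^ (n + 1)) * √(4 - x ^ 2) =
      4 * (n + 1) * (x ^ n * √(4 - x ^ 2)) - (n + 4) * (x ^ (n + 2) * √(4 - x ^ 2)) := by
    intro x; ring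
  simp only [this] at h
  rw [intervalIntegral.integral_sub (Continuous.intervalIntegrable (by fun_prop) _ _)
    (Continuous.intervalIntegrable (by fun_prop) _ _), intervalIntegral.integral_const_mul,
    intervalIntegral.integral_const_mul] at h
  linarith

lemma semicircle_moment (m : ℕ) :
    1 / (2 * Real.pi) * ∫ x in (-2 : ℝ)..2, x ^ m * √(4 - x ^ 2) = aeratedCatalan m := by
  have hpi := Real.pi_pos
  induction m using Nat.twoStepInduction with
  | zero =>
    simp only [pow_zero, one_mul, integral_semicircle_zero]
    simp [aeratedCatalan]
    field_simp
  | one =>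
    simp only [pow_one, integral_semicircle_one]
    simp [aeratedCatalan]
  | more n ih _ =>
    have h1 := integral_semicircle_add_two n
    have h2 : ((n : ℝ) + 4) * aeratedCatalan (n + 2) = 4 * (n + 1) * aeratedCatalan n := by
      exact_mod_cast add_four_mul_aeratedCatalan n
    have h4 : (n : ℝ) + 4 ≠ 0 := by positivity
    apply mul_left_cancel₀ h4
    rw [h2, ← ih, mul_left_comm, h1]
    ring

/-! ### Counting non-crossing pairings -/

/-- The convolution recursion of the Catalan numbers; splittings into odd parts contribute zero. -/
lemma sum_aeratedCatalan (n : ℕ) :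
    ∑ ij ∈ Finset.HasAntidiagonal.antidiagonal n, aeratedCatalan ij.1 * aeratedCatalan ij.2 =
      aeratedCatalan (n + 2) := by
  rcases Nat.even_or_odd' n with ⟨k, rfl | rfl⟩
  · rw [show 2 * k + 2 = 2 * (k + 1) by ring, aeratedCatalan_two_mul, catalan_succ']
    symm
    refine Finset.sum_of_injOn (fun ij => (2 * ij.1, 2 * ij.2)) ?_ ?_ ?_ ?_
    · rintro ⟨a, b⟩ - ⟨c, d⟩ - h
      simpa using h
    · rintro ⟨a, b⟩ h
      simp only [SetLike.mem_coe, Finset.HasAntidiagonal.mem_antidiagonal] at h ⊢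
      omega
    · rintro ⟨a, b⟩ h h'
      simp only [Finset.HasAntidiagonal.mem_antidiagonal] at h
      simp only [Set.mem_image, SetLike.mem_coe, Finset.HasAntidiagonal.mem_antidiagonal, Prod.exists,
        Prod.mk.injEq, not_exists, not_and] at h'
      rcases Nat.even_or_odd' a with ⟨c, rfl | rfl⟩
      · exact absurd (show 2 * (k - c) = b by omega) (h' c (k - c) (by omega) rfl)
      · rw [aeratedCatalan_of_odd (by simp [parity_simps]), zero_mul]
    · rintro ⟨a, b⟩ _
      simp [aeratedCatalan_two_mul]
  · rw [aeratedCatalan_of_odd (by simp [parity_simps])]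
    refine Finset.sum_eq_zero ?_
    rintro ⟨a, b⟩ h
    simp only [Finset.HasAntidiagonal.mem_antidiagonal] at h
    by_cases ha : Even a
    · rw [aeratedCatalan_of_odd (n := b), mul_zero]
      intro hb
      have := ha.add hb
      rw [h] at this
      simp [parity_simps] at this
    · rw [aeratedCatalan_of_odd ha, zero_mul]

/-- `f` is a non-crossing pairing of the integers in `[a, b)`, encoded as a fixed-point-free
involution of that interval and extended by the identity to all of `ℕ`. -/
structure IsNCInvolution (a b : ℕ) (f : ℕ → ℕ) : Prop where
  invol : ∀ x, f (f x) = x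
  maps : ∀ x, a ≤ x → x < b → a ≤ f x ∧ f x < b ∧ f x ≠ x
  left : ∀ x, x < a → f x = x
  right : ∀ x, b ≤ x → f x = x
  noncross : ∀ i j, ¬ (i < j ∧ j < f i ∧ f i < f j)

/-- `f` on `[a, b)`, the identity elsewhere. -/
def restrictIco (a b : ℕ) (f : ℕ → ℕ) (x : ℕ) : ℕ := if a ≤ x ∧ x < b then f x else x

/-- The arc `{a, c}` with `f` under it and `g` behind it. -/
def joinArc (a c : ℕ) (f g : ℕ → ℕ) (x : ℕ) : ℕ :=
  if x = a then c else if x = c then a else if x < c then f x else g x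

/-- The restriction of a non-crossing pairing to a subinterval that it maps to itself. -/
lemma IsNCInvolution.restrict {a b l u : ℕ} {f : ℕ → ℕ} (hf : IsNCInvolution a b f) (hl : a ≤ l)
    (hu : u ≤ b) (h : ∀ x, l ≤ x → x < u → l ≤ f x ∧ f x < u) :
    IsNCInvolution l u (restrictIco l u f) := by
  have key : ∀ x, (l ≤ x ∧ x < u ∧ restrictIco l u f x = f x ∧ l ≤ f x ∧ f x < u) ∨
      ((x < l ∨ u ≤ x) ∧ restrictIco l u f x = x) := by
    intro x
    unfold restrictIco
    by_cases hx : l ≤ x ∧ x < u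
    · rw [if_pos hx]; exact Or.inl ⟨hx.1, hx.2, rfl, h x hx.1 hx.2⟩
    · rw [if_neg hx]; exact Or.inr ⟨by omega, rfl⟩
  refine ⟨fun x => ?_, fun x hx hx' => ?_, fun x hx => ?_, fun x hx => ?_,
    fun i j hij => ?_⟩
  · have h1 := key x
    have h2 := key (f x)
    have h3 := hf.invol x
    rcases h1 with h1 | h1
    · rw [h1.2.2.1]; omega
    · rw [h1.2, h1.2]
  · have h1 := key x
    have h2 := hf.maps x (by omega) (by omega)
    omega
  · have := key x
    omega
  · have := key x
    omega
  · have h1 := key i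
    have h2 := key j
    have h3 := hf.noncross i j
    omega

/-- The arc that starts at `a` separates the points under it from the points behind it. -/
lemma IsNCInvolution.under_arc {a b : ℕ} {f : ℕ → ℕ} (hf : IsNCInvolution a b f) (hab : a < b)
    (x : ℕ) : (a + 1 ≤ x → x < f a → a + 1 ≤ f x ∧ f x < f a) ∧
      (f a + 1 ≤ x → x < b → f a + 1 ≤ f x ∧ f x < b) := by
  have h1 := hf.maps a le_rfl hab
  have h2 := hf.maps x
  have h3 := hf.noncross a x
  have h4 := hf.noncross a (f x)
  have h5 := hf.invol x
  have h6 := hf.invol a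
  have h7 : f x = a → x = f a := fun h => by rw [← h, h5]
  have h8 : f x = f a → x = a := fun h => by rw [← h5, h, h6]
  rw [h5] at h4
  constructor <;> intro h h' <;> omega

lemma isNCInvolution_joinArc {a b c : ℕ} {f g : ℕ → ℕ} (hac : a < c) (hcb : c < b)
    (hf : IsNCInvolution (a + 1) c f) (hg : IsNCInvolution (c + 1) b g) :
    IsNCInvolution a b (joinArc a c f g) := by
  have key : ∀ x, (x = a ∧ joinArc a c f g x = c) ∨ (x = c ∧ joinArc a c f g x = a) ∨
      (a < x ∧ x < c ∧ joinArc a c f g x = f x ∧ a < f x ∧ f x < c ∧ f x ≠ x) ∨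
      (c < x ∧ x < b ∧ joinArc a c f g x = g x ∧ c < g x ∧ g x < b ∧ g x ≠ x) ∨
      ((x < a ∨ b ≤ x) ∧ joinArc a c f g x = x) := by
    intro x
    have h1 := hf.maps x
    have h2 := hg.maps x
    have h3 := hf.left x
    have h4 := hg.right x
    unfold joinArc
    split_ifs <;> omega
  refine ⟨fun x => ?_, fun x hx hx' => ?_, fun x hx => ?_, fun x hx => ?_,
    fun i j hij => ?_⟩
  · have h1 := key (joinArc a c f g x)
    have h2 := hf.invol x
    have h3 := hg.invol x
    rcases key x with h | h | h | h | h
    · rw [h.2] at h1 ⊢; omega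
    · rw [h.2] at h1 ⊢; omega
    · rw [h.2.2.1] at h1 ⊢; omega
    · rw [h.2.2.1] at h1 ⊢; omega
    · rw [h.2, h.2]
  · have := key x
    omega
  · have := key x
    omega
  · have := key x
    omega
  · have h1 := key i
    have h2 := key j
    have h3 := hf.noncross i j
    have h4 := hg.noncross i j
    omega

/-- Non-crossing pairings of `[a, b)` whose first point is paired with `c` amount to two
non-crossing pairings, of the points under the arc `{a, c}` and of the points behind it. -/
def ncInvolutionFiberEquiv {a b c : ℕ} (hac : a < c) (hcb : c < b) :
    {f : {f // IsNCInvolution a b f} // f.1 a = c} ≃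
      {f // IsNCInvolution (a + 1) c f} × {f // IsNCInvolution (c + 1) b f} where
  toFun f := (⟨restrictIco (a + 1) c f.1.1, by
      have h := f.1.2.under_arc (hac.trans hcb)
      simp only [f.2] at h
      exact f.1.2.restrict (by omega) (by omega) fun x => (h x).1⟩,
    ⟨restrictIco (c + 1) b f.1.1, by
      have h := f.1.2.under_arc (hac.trans hcb)
      simp only [f.2] at h
      exact f.1.2.restrict (by omega) (by omega) fun x => (h x).2⟩)
  invFun fg := ⟨⟨joinArc a c fg.1.1 fg.2.1, isNCInvolution_joinArc hac hcb fg.1.2 fg.2.2⟩,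
    by simp [joinArc]⟩
  left_inv := by
    rintro ⟨⟨f, hf⟩, hc⟩
    simp only [Subtype.mk.injEq]
    funext x
    simp only at hc
    have h0 := hf.invol a
    have h1 := hf.left x
    have h2 := hf.right x
    rw [hc] at h0
    unfold joinArc restrictIco
    split_ifs with h3 h4 <;> first | (subst h3; omega) | (subst h4; omega) | omega
  right_inv := by
    rintro ⟨⟨f, hf⟩, ⟨g, hg⟩⟩
    simp only [Prod.mk.injEq, Subtype.mk.injEq]
    constructor
    · funext x
      have h1 := hf.left x
      have h2 := hf.right x
      change restrictIco (a + 1) c (joinArc a c f g) x = f x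
      simp only [restrictIco, joinArc]
      split_ifs <;> omega
    · funext x
      have h1 := hg.left x
      have h2 := hg.right x
      change restrictIco (c + 1) b (joinArc a c f g) x = g x
      simp only [restrictIco, joinArc]
      split_ifs <;> omega

/-- Finiteness is carried along the induction, since `Nat.card` of an infinite type is zero. -/
lemma card_ncInvolution (n : ℕ) : ∀ a, Finite {f // IsNCInvolution a (a + n) f} ∧
    Nat.card {f // IsNCInvolution a (a + n) f} = aeratedCatalan n := by
  induction n using Nat.strong_induction_on with
  | _ n ih =>
    intro a
    match n, ih with
    | 0, _ =>
      have huniq : ∀ f : {f // IsNCInvolution a (a + 0) f}, f.1 = id := fun f => by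
        funext x
        have h1 := f.2.left x
        have h2 := f.2.right x
        simp only [id]
        omega
      have : Unique {f // IsNCInvolution a (a + 0) f} :=
        { default := ⟨id, fun _ => rfl, fun _ _ _ => by omega, fun _ _ => rfl, fun _ _ => rfl,
            fun i j => by simp only [id]; omega⟩
          uniq := fun f => Subtype.ext (huniq f) }
      exact ⟨inferInstance, by simp [aeratedCatalan]⟩
    | 1, _ =>
      have : IsEmpty {f // IsNCInvolution a (a + 1) f} := ⟨fun f => by
        have := f.2.maps a le_rfl (by omega)
        omega⟩
      exact ⟨inferInstance, by simp [aeratedCatalan]⟩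
    | n + 2, ih =>
      -- `c : Fin (n + 1)` stands for the partner `a + 1 + c` of the first point
      let g : {f // IsNCInvolution a (a + (n + 2)) f} → Fin (n + 1) := fun f =>
        ⟨f.1 a - a - 1, by have := f.2.maps a le_rfl (by omega); omega⟩
      have e : ∀ c : Fin (n + 1), {f // g f = c} ≃
          {f // IsNCInvolution (a + 1) (a + 1 + c) f} ×
            {f // IsNCInvolution (a + 2 + c) (a + 2 + c + (n - c)) f} := by
        intro c
        have hc := c.2
        refine (Equiv.subtypeEquivRight fun f => ?_).trans
          ((ncInvolutionFiberEquiv (a := a) (b := a + (n + 2)) (c := a + 1 + c) (by omega)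
            (by omega)).trans (Equiv.prodCongr (Equiv.refl _) (Equiv.subtypeEquivRight fun f => ?_)))
        · have := f.2.maps a le_rfl (by omega)
          simp only [g, Fin.ext_iff]
          omega
        · rw [show a + 1 + (c : ℕ) + 1 = a + 2 + c by omega,
            show a + (n + 2) = a + 2 + c + (n - c) by omega]
      have hfin : ∀ c, Finite {f // g f = c} := fun c => by
        have h1 := (ih c (by omega) (a + 1)).1
        have h2 := (ih (n - c) (by omega) (a + 2 + c)).1
        exact Finite.of_equiv _ (e c).symm
      refine ⟨Finite.of_equiv _ (Equiv.sigmaFiberEquiv g), ?_⟩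
      rw [← Nat.card_congr (Equiv.sigmaFiberEquiv g), Nat.card_sigma, ← sum_aeratedCatalan,
        Finset.Nat.sum_antidiagonal_eq_sum_range_succ_mk, ← Fin.sum_univ_eq_sum_range
          (fun c => aeratedCatalan c * aeratedCatalan (n - c))]
      refine Finset.sum_congr rfl fun c _ => ?_
      rw [Nat.card_congr (e c), Nat.card_prod, (ih c (by omega) (a + 1)).2,
        (ih (n - c) (by omega) (a + 2 + c)).2]

/-- The partner function of a partition into blocks of size two. -/
lemma Setoid.exists_partner {α : Type*} (π : Setoid α) (h : ∀ r, {s | π r s}.ncard = 2) :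
    ∃ f : α → α, (∀ r, f r ≠ r) ∧ (∀ r, f (f r) = r) ∧ ∀ r s, π r s ↔ s = r ∨ s = f r := by
  have h1 : ∀ r, ∃ y, y ≠ r ∧ ∀ s, π r s ↔ s = r ∨ s = y := by
    intro r
    obtain ⟨x, y, hxy, hs⟩ := Set.ncard_eq_two.1 (h r)
    have hr : r ∈ ({x, y} : Set α) := hs ▸ π.refl r
    have hs' : ∀ s, π r s ↔ s = x ∨ s = y := fun s => Set.ext_iff.1 hs s
    rcases hr with rfl | rfl
    · exact ⟨y, hxy.symm, hs'⟩
    · exact ⟨x, hxy, fun s => (hs' s).trans or_comm⟩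
  choose f hf hπ using h1
  refine ⟨f, hf, fun r => ?_, hπ⟩
  have : π (f r) r := π.symm ((hπ _ _).2 (Or.inr rfl))
  rcases (hπ _ _).1 this with h | h
  · exact absurd h.symm (hf r)
  · exact h.symm

/-- A non-crossing pairing seen as an involution. -/
lemma exists_partner_of_mem_nonCrossingPairings {m : ℕ} {π : Setoid (Fin m)}
    (h : π ∈ nonCrossingPairings m) :
    ∃ f : Fin m → Fin m, (∀ r, f r ≠ r) ∧ (∀ r, f (f r) = r) ∧
      (∀ r s, π r s ↔ s = r ∨ s = f r) ∧ ∀ i j, ¬ (i < j ∧ j < f i ∧ f i < f j) := by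
  obtain ⟨f, h1, h2, h3⟩ := π.exists_partner h.1
  exact ⟨f, h1, h2, h3, fun i j hij =>
    h.2 ⟨i, j, f i, f j, hij.1, hij.2.1, hij.2.2, (h3 _ _).2 (Or.inr rfl),
      (h3 _ _).2 (Or.inr rfl)⟩⟩

/-- The partition of `[m]` into the orbits of a non-crossing involution. -/
def IsNCInvolution.setoid {m : ℕ} {f : ℕ → ℕ} (hf : IsNCInvolution 0 m f) : Setoid (Fin m) where
  r r s := (s : ℕ) = r ∨ (s : ℕ) = f r
  iseqv := by
    refine ⟨fun r => Or.inl rfl, ?_, ?_⟩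
    · rintro r s (h | h)
      · exact Or.inl h.symm
      · right; rw [h, hf.invol]
    · rintro r s t (h | h) (h' | h')
      · left; omega
      · right; rw [h', h]
      · right; omega
      · left; rw [h', h, hf.invol]

lemma IsNCInvolution.setoid_apply {m : ℕ} {f : ℕ → ℕ} (hf : IsNCInvolution 0 m f) (r s : Fin m) :
    hf.setoid r s ↔ (s : ℕ) = r ∨ (s : ℕ) = f r := Iff.rfl

lemma IsNCInvolution.setoid_mem {m : ℕ} {f : ℕ → ℕ} (hf : IsNCInvolution 0 m f) :
    hf.setoid ∈ nonCrossingPairings m := by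
  refine ⟨fun r => ?_, ?_⟩
  · have hr := hf.maps r (by omega) r.2
    refine Set.ncard_eq_two.2 ⟨r, ⟨f r, hr.2.1⟩, fun h => hr.2.2 (Fin.ext_iff.1 h).symm, ?_⟩
    ext s
    simp [hf.setoid_apply, Fin.ext_iff]
  · rintro ⟨i, j, k, l, hij, hjk, hkl, h1, h2⟩
    rw [hf.setoid_apply] at h1 h2
    have := hf.noncross i j
    simp only [Fin.lt_def] at hij hjk hkl
    omega

lemma ncard_nonCrossingPairings (m : ℕ) :
    (nonCrossingPairings m).ncard = aeratedCatalan m := by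
  have h0 := (card_ncInvolution m 0).2
  rw [zero_add] at h0
  rw [← h0, ← Nat.card_coe_set_eq]
  symm
  refine Nat.card_eq_of_bijective
    (fun f : {f // IsNCInvolution 0 m f} =>
      (⟨f.2.setoid, f.2.setoid_mem⟩ : nonCrossingPairings m)) ⟨?_, ?_⟩
  · rintro ⟨f, hf⟩ ⟨g, hg⟩ h
    simp only [Subtype.mk.injEq] at h ⊢
    funext x
    by_cases hx : x < m
    · have h1 := hf.maps x (by omega) hx
      have h2 : hf.setoid ⟨x, hx⟩ ⟨f x, h1.2.1⟩ := Or.inr rfl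
      rw [h, hg.setoid_apply] at h2
      exact h2.resolve_left h1.2.2
    · rw [hf.right x (by omega), hg.right x (by omega)]
  · rintro ⟨π, hπ⟩
    obtain ⟨g, h1, h2, h3, h4⟩ := exists_partner_of_mem_nonCrossingPairings hπ
    let f : ℕ → ℕ := fun x => if h : x < m then g ⟨x, h⟩ else x
    have hlt : ∀ x (h : x < m), f x = g ⟨x, h⟩ := fun x h => dif_pos h
    have hge : ∀ x, m ≤ x → f x = x := fun x h => dif_neg (by omega)
    have hmaps : ∀ x, x < m → f x < m := fun x h => by rw [hlt x h]; exact (g _).2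
    have hf : IsNCInvolution 0 m f := by
      refine ⟨fun x => ?_, fun x _ hx => ⟨by omega, hmaps x hx, ?_⟩, fun x hx => by omega, hge,
        fun i j hij => ?_⟩
      · by_cases hx : x < m
        · have := hmaps x hx
          rw [hlt _ this]
          simp only [hlt x hx, Fin.eta, h2]
        · rw [hge x (by omega), hge x (by omega)]
      · rw [hlt x hx]
        intro h
        exact h1 ⟨x, hx⟩ (Fin.ext h)
      · have hj : j < m := by
          by_contra hj
          have := hge j (by omega)
          omega
        have hi : i < m := by omega
        refine h4 ⟨i, hi⟩ ⟨j, hj⟩ ?_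
        rw [hlt i hi, hlt j hj] at hij
        exact hij
    refine ⟨⟨f, hf⟩, ?_⟩
    simp only [Subtype.mk.injEq]
    ext r s
    rw [hf.setoid_apply, hlt r r.2, h3]
    simp [Fin.ext_iff]

/-! ### The two sides of an edge of a tree -/

namespace SimpleGraph

variable {V : Type*} {G : SimpleGraph V}

/-- `u` lies on the same side of the edge `e` as `a`. -/
def SameSide (G : SimpleGraph V) (a : V) (e : Sym2 V) (u : V) : Prop :=
  (G.deleteEdges {e}).Reachable a u

lemma SameSide.refl (a : V) (e : Sym2 V) : G.SameSide a e a := Reachable.refl a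

lemma sameSide_congr_of_ne (a : V) {e : Sym2 V} {u x : V} (h : G.Adj u x) (he : s(u, x) ≠ e) :
    G.SameSide a e u ↔ G.SameSide a e x := by
  have hadj : (G.deleteEdges {e}).Adj u x := by
    rw [deleteEdges_adj]
    exact ⟨h, he⟩
  exact ⟨fun h' => h'.trans hadj.reachable, fun h' => h'.trans hadj.reachable.symm⟩

/-- Deleting one edge of a connected graph leaves every vertex connected to one of its ends. -/
lemma reachable_deleteEdges_or (u x : V) {y : V} (h : G.Reachable u y) :
    (G.deleteEdges {s(u, x)}).Reachable u y ∨ (G.deleteEdges {s(u, x)}).Reachable x y := by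
  obtain ⟨p⟩ := h.symm
  suffices H : ∀ {y z : V} (p : G.Walk y z), z = u →
      (G.deleteEdges {s(u, x)}).Reachable u y ∨ (G.deleteEdges {s(u, x)}).Reachable x y from
    H p rfl
  intro y z p
  induction p with
  | nil => rintro rfl; exact Or.inl (Reachable.refl _)
  | @cons a b c hab p ih =>
    intro hc
    by_cases he : s(a, b) = s(u, x)
    · rcases Sym2.eq_iff.1 he with ⟨rfl, rfl⟩ | ⟨rfl, rfl⟩
      · exact Or.inl (Reachable.refl _)
      · exact Or.inr (Reachable.refl _)
    · have hadj : (G.deleteEdges {s(u, x)}).Adj b a := by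
        rw [deleteEdges_adj]
        exact ⟨hab.symm, fun h => he (Sym2.eq_swap.trans h)⟩
      exact (ih hc).imp (fun h => h.trans hadj.reachable) fun h => h.trans hadj.reachable

/-- Since the edges of a tree are bridges, traversing an edge changes sides. -/
lemma IsTree.not_sameSide_congr (hG : G.IsTree) (a : V) {u x : V} (h : G.Adj u x) :
    ¬ (G.SameSide a s(u, x) u ↔ G.SameSide a s(u, x) x) := by
  have hb : ¬ (G.deleteEdges {s(u, x)}).Reachable u x :=
    isBridge_iff.1 (isAcyclic_iff_forall_isBridge.1 hG.isAcyclic h)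
  intro hiff
  have : G.SameSide a s(u, x) u ∨ G.SameSide a s(u, x) x :=
    (reachable_deleteEdges_or u x (hG.connected u a)).imp Reachable.symm Reachable.symm
  have h1 : G.SameSide a s(u, x) u := by tauto
  exact hb (h1.symm.trans (hiff.1 h1))

/-- Two vertices of a tree that no edge separates are equal: the first edge of a path between them
would do so. -/
lemma IsTree.eq_of_forall_sameSide_congr (hG : G.IsTree) (a : V) {u x : V}
    (h : ∀ e ∈ G.edgeSet, G.SameSide a e u ↔ G.SameSide a e x) : u = x := by
  classical
  obtain ⟨p, hp⟩ := (hG.connected u x).exists_isPath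
  cases p with
  | nil => rfl
  | @cons _ b _ hab p =>
    exfalso
    have htrail := hp.isTrail
    rw [Walk.isTrail_cons] at htrail
    have key : ∀ {y z : V} (q : G.Walk y z), s(u, b) ∉ q.edges →
        (G.SameSide a s(u, b) y ↔ G.SameSide a s(u, b) z) := by
      intro y z q
      induction q with
      | nil => simp
      | cons hcd q ih =>
        intro hq
        simp only [Walk.edges_cons, List.mem_cons, not_or] at hq
        exact (sameSide_congr_of_ne a hcd (Ne.symm hq.1)).trans (ih hq.2)
    exact hG.not_sameSide_congr a hab ((h _ hab).trans (key p htrail.2).symm)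

end SimpleGraph

/-! ### The closed walk of a partition -/

/-- The block visited at time `t` by the closed walk of `σ`, times being read modulo `n + 1`. -/
def walkVertex {n : ℕ} (σ : Setoid (Fin (n + 1))) (t : ℕ) : Quotient σ :=
  Quotient.mk σ (Fin.ofNat (n + 1) t)

/-- The number of times the closed walk of `σ` uses the edge `e`. -/
noncomputable def edgeCount {m : ℕ} (σ : Setoid (Fin m)) (e : Sym2 (Quotient σ)) : ℕ :=
  {r | stepEdge σ r = e}.ncard

section Walk

variable {n : ℕ} (σ : Setoid (Fin (n + 1)))

lemma walkVertex_val (r : Fin (n + 1)) : walkVertex σ r = Quotient.mk σ r := by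
  simp [walkVertex]

lemma walkVertex_last : walkVertex σ (n + 1) = walkVertex σ 0 := by
  simp [walkVertex, Fin.ofNat]

lemma walkVertex_val_add_one (r : Fin (n + 1)) :
    walkVertex σ (r + 1) = Quotient.mk σ (finRotate (n + 1) r) := by
  rw [walkVertex]
  congr 1
  rw [finRotate_apply]
  ext
  simp [Fin.val_add]

lemma stepEdge_eq (r : Fin (n + 1)) :
    stepEdge σ r = s(walkVertex σ r, walkVertex σ (r + 1)) := by
  rw [walkVertex_val, walkVertex_val_add_one, stepEdge]

/-- The graph of the closed walk is connected. -/
lemma partitionGraph_connected :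
    (SimpleGraph.fromEdgeSet (partitionGraphEdges σ)).Connected := by
  have key : ∀ t ≤ n, (SimpleGraph.fromEdgeSet (partitionGraphEdges σ)).Reachable
      (walkVertex σ 0) (walkVertex σ t) := by
    intro t
    induction t with
    | zero => intro _; exact SimpleGraph.Reachable.refl _
    | succ t ih =>
      intro ht
      refine (ih (by omega)).trans ?_
      by_cases h : walkVertex σ t = walkVertex σ (t + 1)
      · rw [h]
      · refine SimpleGraph.Adj.reachable ?_
        rw [SimpleGraph.fromEdgeSet_adj]
        exact ⟨⟨⟨t, by omega⟩, stepEdge_eq σ ⟨t, by omega⟩⟩, h⟩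
  have key' : ∀ u, (SimpleGraph.fromEdgeSet (partitionGraphEdges σ)).Reachable
      (walkVertex σ 0) u := by
    intro u
    obtain ⟨r, rfl⟩ := Quotient.exists_rep u
    have := key r (by omega)
    rwa [walkVertex_val] at this
  have : Nonempty (Quotient σ) := ⟨walkVertex σ 0⟩
  exact ⟨fun u v => (key' u).symm.trans (key' v)⟩

variable {σ}

lemma edgeCount_stepEdge (r : Fin (n + 1)) :
    edgeCount σ (stepEdge σ r) = {s | stepPairing σ r s}.ncard := by
  change Set.ncard _ = _
  congr 1
  ext s
  exact eq_comm

/-- The steps are distributed over the edges. -/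
lemma sum_edgeCount [DecidableEq (Sym2 (Quotient σ))] :
    ∑ e ∈ Finset.univ.image (stepEdge σ), edgeCount σ e = n + 1 := by
  have h := Finset.card_eq_sum_card_fiberwise (s := Finset.univ)
    (t := Finset.univ.image (stepEdge σ)) (f := stepEdge σ) (fun r _ => by simp)
  rw [Finset.card_univ, Fintype.card_fin] at h
  refine Eq.trans ?_ h.symm
  refine Finset.sum_congr rfl fun e _ => ?_
  rw [edgeCount, ← Set.ncard_coe_finset]
  simp

lemma ncard_partitionGraphEdges [DecidableEq (Sym2 (Quotient σ))] :
    (partitionGraphEdges σ).ncard = (Finset.univ.image (stepEdge σ)).card := by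
  rw [partitionGraphEdges, ← Set.image_univ, ← Finset.coe_univ, ← Finset.coe_image,
    Set.ncard_coe_finset]

/-- If no edge is used exactly once, then there are at most `m / 2` edges. -/
lemma two_mul_ncard_edges_le (h : ∀ r, 2 ≤ edgeCount σ (stepEdge σ r)) :
    2 * (partitionGraphEdges σ).ncard ≤ n + 1 := by
  classical
  refine le_trans ?_ (sum_edgeCount (σ := σ)).le
  rw [ncard_partitionGraphEdges, mul_comm, ← smul_eq_mul]
  refine Finset.card_nsmul_le_sum _ _ _ fun e he => ?_
  simp only [Finset.mem_image, Finset.mem_univ, true_and] at he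
  obtain ⟨r, rfl⟩ := he
  exact h r

/-- If no edge is used exactly once and there are `m / 2` edges, then every edge is used exactly
twice. -/
lemma edgeCount_eq_two (h : ∀ r, 2 ≤ edgeCount σ (stepEdge σ r))
    (hc : 2 * (partitionGraphEdges σ).ncard = n + 1) (r : Fin (n + 1)) :
    edgeCount σ (stepEdge σ r) = 2 := by
  classical
  have h1 : ∑ _e ∈ Finset.univ.image (stepEdge σ), 2 =
      ∑ e ∈ Finset.univ.image (stepEdge σ), edgeCount σ e := by
    refine Eq.trans ?_ (hc.trans (sum_edgeCount (σ := σ)).symm)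
    rw [ncard_partitionGraphEdges, Finset.sum_const, smul_eq_mul, mul_comm]
  rw [Finset.sum_eq_sum_iff_of_le] at h1
  · exact (h1 _ (Finset.mem_image_of_mem _ (Finset.mem_univ r))).symm
  · intro e he
    simp only [Finset.mem_image, Finset.mem_univ, true_and] at he
    obtain ⟨r, rfl⟩ := he
    exact h r

lemma ncard_edgeSet_le :
    Nat.card (SimpleGraph.fromEdgeSet (partitionGraphEdges σ)).edgeSet ≤
      (partitionGraphEdges σ).ncard := by
  rw [Nat.card_coe_set_eq, SimpleGraph.edgeSet_fromEdgeSet]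
  exact Set.ncard_le_ncard Set.sdiff_subset

lemma edgeSet_eq_of_noLoops (h : ∀ e ∈ partitionGraphEdges σ, ¬ e.IsDiag) :
    (SimpleGraph.fromEdgeSet (partitionGraphEdges σ)).edgeSet = partitionGraphEdges σ := by
  rw [SimpleGraph.edgeSet_fromEdgeSet, sdiff_eq_left]
  exact Set.disjoint_left.2 fun e he he' => h e he he'

lemma ncard_vertices_le :
    Nat.card (Quotient σ) ≤ (partitionGraphEdges σ).ncard + 1 :=
  (partitionGraph_connected σ).card_vert_le_card_edgeSet_add_one.trans
    (Nat.add_le_add_right ncard_edgeSet_le 1)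

/-- A closed walk with one more vertex than edges (loops included) is a walk on a tree. -/
lemma partitionGraphIsTree_of_card
    (h : Nat.card (Quotient σ) = (partitionGraphEdges σ).ncard + 1) :
    PartitionGraphIsTree σ := by
  have h1 := (partitionGraph_connected σ).card_vert_le_card_edgeSet_add_one
  have h2 := ncard_edgeSet_le (σ := σ)
  refine ⟨fun e he hd => ?_, SimpleGraph.isTree_iff_connected_and_card.2
    ⟨partitionGraph_connected σ, by omega⟩⟩
  have h3 : Nat.card (SimpleGraph.fromEdgeSet (partitionGraphEdges σ)).edgeSet <
      (partitionGraphEdges σ).ncard := by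
    rw [Nat.card_coe_set_eq, SimpleGraph.edgeSet_fromEdgeSet]
    exact Set.ncard_lt_ncard ⟨Set.sdiff_subset, fun hsub => (hsub he).2 hd⟩
  omega

lemma ncard_edges_of_mem_treePartitions (hσ : σ ∈ treePartitions (n + 1)) :
    2 * (partitionGraphEdges σ).ncard = n + 1 := by
  have h1 := (SimpleGraph.isTree_iff_connected_and_card.1 hσ.1.2).2
  have h2 := hσ.2
  rw [Nat.card_coe_set_eq, edgeSet_eq_of_noLoops hσ.1.1] at h1
  omega

/-! ### From trees to non-crossing pairings -/

/-- Each step of the walk on a tree changes sides with respect to its own edge only. -/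
lemma sameSide_step (hσ : PartitionGraphIsTree σ) (e : Sym2 (Quotient σ)) {t : ℕ}
    (ht : t < n + 1) :
    ((SimpleGraph.fromEdgeSet (partitionGraphEdges σ)).SameSide (walkVertex σ 0) e
        (walkVertex σ t) ↔
      (SimpleGraph.fromEdgeSet (partitionGraphEdges σ)).SameSide (walkVertex σ 0) e
        (walkVertex σ (t + 1))) ↔ stepEdge σ ⟨t, ht⟩ ≠ e := by
  have he := stepEdge_eq σ ⟨t, ht⟩
  simp only at he
  have hadj : (SimpleGraph.fromEdgeSet (partitionGraphEdges σ)).Adj (walkVertex σ t)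
      (walkVertex σ (t + 1)) := by
    rw [SimpleGraph.fromEdgeSet_adj, ← he]
    refine ⟨⟨_, rfl⟩, fun h => hσ.1 _ ⟨⟨t, ht⟩, rfl⟩ ?_⟩
    rw [he, h]
    exact Sym2.mk_isDiag_iff.2 rfl
  constructor
  · rintro h rfl
    rw [he] at h
    exact hσ.2.not_sameSide_congr _ hadj h
  · intro h
    rw [he] at h
    exact SimpleGraph.sameSide_congr_of_ne _ hadj h

/-- A closed walk on a tree uses no edge exactly once, as it has to return to the side of the edge
on which it started. -/
lemma exists_ne_stepEdge_eq (hσ : PartitionGraphIsTree σ) (r : Fin (n + 1)) :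
    ∃ s ≠ r, stepEdge σ s = stepEdge σ r := by
  by_contra! hcon
  have key : ∀ t, t ≤ n + 1 →
      ((SimpleGraph.fromEdgeSet (partitionGraphEdges σ)).SameSide (walkVertex σ 0) (stepEdge σ r)
        (walkVertex σ t) ↔ t ≤ r) := by
    intro t
    induction t with
    | zero => exact fun _ => iff_of_true (SimpleGraph.SameSide.refl _ _) (Nat.zero_le _)
    | succ t ih =>
      intro ht
      have h1 := ih (by omega)
      have h2 := sameSide_step hσ (stepEdge σ r) (t := t) ht
      rw [h1] at h2
      by_cases htr : t = r
      · have : (⟨t, ht⟩ : Fin (n + 1)) = r := Fin.ext htr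
        rw [this] at h2
        have h3 : ¬ (t + 1 ≤ (r : ℕ)) := by omega
        have h4 : t ≤ (r : ℕ) := by omega
        tauto
      · have h5 := h2.2 (hcon ⟨t, ht⟩ fun h => htr (Fin.ext_iff.1 h))
        rw [← h5]
        omega
  have h1 := (key (n + 1) le_rfl).1 (by rw [walkVertex_last]; exact SimpleGraph.SameSide.refl _ _)
  omega

lemma two_le_edgeCount (hσ : PartitionGraphIsTree σ) (r : Fin (n + 1)) :
    2 ≤ edgeCount σ (stepEdge σ r) := by
  obtain ⟨s, hs, he⟩ := exists_ne_stepEdge_eq hσ r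
  rw [← Set.ncard_pair hs]
  refine Set.ncard_le_ncard ?_
  rintro x (rfl | rfl)
  · exact he
  · rfl

lemma edgeCount_of_mem_treePartitions (hσ : σ ∈ treePartitions (n + 1)) (r : Fin (n + 1)) :
    edgeCount σ (stepEdge σ r) = 2 :=
  edgeCount_eq_two (two_le_edgeCount hσ.1) (ncard_edges_of_mem_treePartitions hσ) r

lemma ncard_stepPairing (hσ : σ ∈ treePartitions (n + 1)) (r : Fin (n + 1)) :
    {s | stepPairing σ r s}.ncard = 2 := by
  rw [← edgeCount_stepEdge, edgeCount_of_mem_treePartitions hσ]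

/-- The walk is on the far side of an edge exactly between its two uses. -/
lemma sameSide_iff (hσ : σ ∈ treePartitions (n + 1)) {r s : Fin (n + 1)} (hrs : r < s)
    (h : stepPairing σ r s) {t : ℕ} (ht : t ≤ n + 1) :
    (SimpleGraph.fromEdgeSet (partitionGraphEdges σ)).SameSide (walkVertex σ 0) (stepEdge σ r)
      (walkVertex σ t) ↔ ¬ (r < t ∧ t ≤ s) := by
  have huse : ∀ q : Fin (n + 1), stepEdge σ q = stepEdge σ r ↔ (q : ℕ) = r ∨ (q : ℕ) = s := by
    obtain ⟨f, -, -, hf⟩ := (stepPairing σ).exists_partner (ncard_stepPairing hσ)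
    have hs : s = f r := ((hf r s).1 h).resolve_left hrs.ne'
    intro q
    have := hf r q
    rw [← hs] at this
    rw [← Fin.ext_iff, ← Fin.ext_iff, ← this]
    exact eq_comm
  induction t with
  | zero => exact iff_of_true (SimpleGraph.SameSide.refl _ _) (by omega)
  | succ t ih =>
    have h1 := ih (by omega)
    have h2 := sameSide_step hσ.1 (stepEdge σ r) (t := t) ht
    have hrs' : (r : ℕ) < s := hrs
    simp only [h1, ne_eq, huse] at h2
    by_cases hS : (SimpleGraph.fromEdgeSet (partitionGraphEdges σ)).SameSide (walkVertex σ 0)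
      (stepEdge σ r) (walkVertex σ (t + 1))
    · simp only [hS, iff_true, true_iff] at h2 ⊢
      omega
    · simp only [hS, iff_false, false_iff] at h2 ⊢
      omega

lemma stepPairing_mem (hσ : σ ∈ treePartitions (n + 1)) :
    stepPairing σ ∈ nonCrossingPairings (n + 1) := by
  refine ⟨ncard_stepPairing hσ, ?_⟩
  rintro ⟨i, j, k, l, hij, hjk, hkl, hik, hjl⟩
  have h1 := sameSide_iff hσ (hij.trans hjk) hik (t := j) (by omega)
  have h2 := sameSide_iff hσ (hij.trans hjk) hik (t := l) (by omega)
  have h3 := sameSide_iff hσ (hij.trans hjk) hik (t := l + 1) (by omega)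
  have h4 : stepEdge σ j = stepEdge σ l := hjl
  rw [stepEdge_eq, stepEdge_eq, Sym2.eq_iff] at h4
  simp only [Fin.lt_def] at hij hjk hkl
  rcases h4 with h4 | h4
  · rw [h4.1, h2] at h1
    omega
  · rw [h4.1, h3] at h1
    omega

/-- The blocks of a tree partition can be read off from its step pairing: two times are in the same
block if and only if no edge separates them. -/
lemma treePartitions_rel_iff (hσ : σ ∈ treePartitions (n + 1)) (t u : Fin (n + 1)) :
    σ t u ↔ ∀ r s : Fin (n + 1), r < s → stepPairing σ r s →
      ((r < t ∧ t ≤ s) ↔ (r < u ∧ u ≤ s)) := by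
  rw [← Quotient.eq (r := σ), ← walkVertex_val, ← walkVertex_val]
  constructor
  · intro h r s hrs hp
    have h1 := sameSide_iff hσ hrs hp (t := t) (by omega)
    rw [h, sameSide_iff hσ hrs hp (by omega)] at h1
    simp only [Fin.lt_def, Fin.le_def]
    tauto
  · intro h
    refine hσ.1.2.eq_of_forall_sameSide_congr (walkVertex σ 0) fun e he => ?_
    rw [edgeSet_eq_of_noLoops hσ.1.1] at he
    have key : ∀ r s : Fin (n + 1), r < s → stepEdge σ r = stepEdge σ s →
        ((SimpleGraph.fromEdgeSet (partitionGraphEdges σ)).SameSide (walkVertex σ 0) (stepEdge σ r)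
          (walkVertex σ t) ↔
        (SimpleGraph.fromEdgeSet (partitionGraphEdges σ)).SameSide (walkVertex σ 0) (stepEdge σ r)
          (walkVertex σ u)) := by
      intro r s hrs hp
      rw [sameSide_iff hσ hrs hp (by omega), sameSide_iff hσ hrs hp (by omega)]
      exact not_congr (h r s hrs hp)
    obtain ⟨r, rfl⟩ := he
    obtain ⟨s, hs, hse⟩ := exists_ne_stepEdge_eq hσ.1 r
    rcases lt_or_gt_of_ne hs with hlt | hlt
    · have := key s r hlt hse
      rwa [hse] at this
    · exact key r s hlt hse.symm

lemma injOn_stepPairing : Set.InjOn stepPairing (treePartitions (n + 1)) := by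
  intro σ hσ τ hτ h
  ext t u
  rw [treePartitions_rel_iff hσ, treePartitions_rel_iff hτ, h]

end Walk

/-! ### From non-crossing pairings to trees -/

/-- The first points of the arcs of `f` that are open at time `t`. -/
def openArcs {m : ℕ} (f : Fin m → Fin m) (t : ℕ) : Set (Fin m) :=
  {a | a < f a ∧ (a : ℕ) < t ∧ t ≤ f a}

section OpenArcs

variable {m : ℕ} {f : Fin m → Fin m}

lemma openArcs_zero : openArcs f 0 = ∅ := by
  ext a; simp [openArcs]

lemma openArcs_last : openArcs f m = ∅ := by
  ext a
  simp only [openArcs, Set.mem_ofPred_eq, Set.mem_empty_iff_false, iff_false]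
  omega

/-- The step at the first point `a` of an arc adds `a` to the open arcs. -/
lemma openArcs_add_one {a : Fin m} (hinv : ∀ r, f (f r) = r)
    (ha : a < f a) : openArcs f (a + 1) = insert a (openArcs f a) := by
  ext b
  simp only [openArcs, Set.mem_ofPred_eq, Set.mem_insert_iff, Fin.ext_iff]
  by_cases hb : b = a
  · subst hb
    simp only [Fin.lt_def] at ha
    simp only [Fin.lt_def, true_or, iff_true]
    omega
  · have hb' : (b : ℕ) ≠ a := fun h => hb (Fin.ext h)
    have h2 : f b = a → (f a : ℕ) = b := fun h => by rw [← h, hinv]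
    simp only [Fin.ext_iff] at h2
    simp only [Fin.lt_def] at ha ⊢
    omega

/-- The step at the last point of an arc of a non-crossing pairing traverses backwards the step at
its first point. -/
lemma openArcs_partner {a : Fin m} (hinv : ∀ r, f (f r) = r)
    (hnc : ∀ i j, ¬ (i < j ∧ j < f i ∧ f i < f j)) (ha : a < f a) :
    openArcs f (f a) = openArcs f (a + 1) ∧ openArcs f (f a + 1) = openArcs f a := by
  constructor <;>
  · ext b
    simp only [openArcs, Set.mem_ofPred_eq]
    have h1 := hnc a b
    have h2 := hnc b a
    have h3 : f b = a → (f a : ℕ) = b := fun h => by rw [← h, hinv]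
    have h4 : f b = f a → b = a := fun h => by rw [← hinv b, h, hinv]
    have h5 : b = a → f b = f a := fun h => by rw [h]
    have h6 : b = f a → f b = a := fun h => by rw [h, hinv]
    simp only [Fin.lt_def, Fin.ext_iff] at *
    omega

lemma notMem_openArcs_self (a : Fin m) : a ∉ openArcs f a := fun h => lt_irrefl _ h.2.1

/-- The unordered pair `{B, B ∪ {a}}` with `a ∉ B` determines `a`. -/
lemma eq_of_sym2_insert_eq {α : Type*} {a b : α} {A B : Set α} (ha : a ∉ A) (hb : b ∉ B)
    (h : s(A, insert a A) = s(B, insert b B)) : a = b := by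
  rcases Sym2.eq_iff.1 h with ⟨rfl, h2⟩ | ⟨h1, h2⟩
  · have : a ∈ insert b A := h2 ▸ Set.mem_insert a A
    exact this.resolve_right ha
  · have hA : b ∈ A := h1 ▸ Set.mem_insert b B
    exact absurd (h2 ▸ Set.mem_insert_of_mem a hA) hb

end OpenArcs

/-- The partition of the times according to the set of open arcs. -/
def openArcsSetoid {m : ℕ} (f : Fin m → Fin m) : Setoid (Fin m) :=
  Setoid.ker fun t => openArcs f t

section Surjective

variable {n : ℕ} {f : Fin (n + 1) → Fin (n + 1)}

lemma openArcs_finRotate (r : Fin (n + 1)) :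
    openArcs f (finRotate (n + 1) r) = openArcs f (r + 1) := by
  rw [coe_finRotate]
  split_ifs with h
  · subst h
    rw [openArcs_zero, Fin.val_last, openArcs_last]
  · rfl

lemma stepEdge_openArcsSetoid_eq_iff (r s : Fin (n + 1)) :
    stepEdge (openArcsSetoid f) r = stepEdge (openArcsSetoid f) s ↔
      s(openArcs f r, openArcs f (r + 1)) = s(openArcs f s, openArcs f (s + 1)) := by
  let φ : Quotient (openArcsSetoid f) → Set (Fin (n + 1)) :=
    Quotient.lift (fun t : Fin (n + 1) => openArcs f t) fun _ _ h => h
  have hφ : Function.Injective φ := by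
    rintro ⟨a⟩ ⟨b⟩ h
    exact Quotient.sound h
  rw [← (Sym2.map.injective hφ).eq_iff, ← openArcs_finRotate, ← openArcs_finRotate]
  rfl

/-- The partition of the times according to the set of open arcs is the tree partition that
belongs to a given non-crossing pairing. -/
lemma surjOn_stepPairing :
    Set.SurjOn stepPairing (treePartitions (n + 1)) (nonCrossingPairings (n + 1)) := by
  classical
  intro π hπ
  obtain ⟨f, hne, hinv, hrel, hnc⟩ := exists_partner_of_mem_nonCrossingPairings hπ
  have hopen : ∀ a, a < f a → s(openArcs f a, openArcs f (a + 1)) =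
      s(openArcs f a, insert a (openArcs f a)) := fun a ha => by
    rw [openArcs_add_one hinv ha]
  have hpartner : ∀ a, a < f a → s(openArcs f (f a), openArcs f (f a + 1)) =
      s(openArcs f a, openArcs f (a + 1)) := fun a ha => by
    rw [(openArcs_partner hinv hnc ha).1, (openArcs_partner hinv hnc ha).2, Sym2.eq_swap]
  have hpartner' : ∀ r, stepEdge (openArcsSetoid f) (f r) = stepEdge (openArcsSetoid f) r := by
    intro r
    rw [stepEdge_openArcsSetoid_eq_iff]
    rcases lt_or_gt_of_ne (hne r) with h | h
    · have := hpartner (f r) (by rwa [hinv])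
      rw [hinv] at this
      exact this.symm
    · exact hpartner r h
  have hinj : ∀ a b, a < f a → b < f b →
      stepEdge (openArcsSetoid f) a = stepEdge (openArcsSetoid f) b → a = b := by
    intro a b ha hb h
    rw [stepEdge_openArcsSetoid_eq_iff, hopen a ha, hopen b hb] at h
    exact eq_of_sym2_insert_eq (notMem_openArcs_self a) (notMem_openArcs_self b) h
  have hfirst : ∀ r, ∃ a, a < f a ∧ (r = a ∨ r = f a) := by
    intro r
    rcases lt_or_gt_of_ne (hne r) with h | h
    · exact ⟨f r, by rwa [hinv], Or.inr (hinv r).symm⟩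
    · exact ⟨r, h, Or.inl rfl⟩
  have hstep : stepPairing (openArcsSetoid f) = π := by
    ext r s
    change stepEdge (openArcsSetoid f) r = stepEdge (openArcsSetoid f) s ↔ π r s
    rw [hrel]
    constructor
    · intro h
      obtain ⟨a, ha, hra⟩ := hfirst r
      obtain ⟨b, hb, hsb⟩ := hfirst s
      have hea : stepEdge (openArcsSetoid f) r = stepEdge (openArcsSetoid f) a := by
        rcases hra with rfl | rfl
        · rfl
        · exact hpartner' a
      have heb : stepEdge (openArcsSetoid f) s = stepEdge (openArcsSetoid f) b := by
        rcases hsb with rfl | rfl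
        · rfl
        · exact hpartner' b
      have hab : a = b := hinj a b ha hb (by rw [← hea, ← heb, h])
      subst hab
      rcases hra with rfl | rfl <;> rcases hsb with rfl | rfl <;> simp [hinv]
    · rintro (rfl | rfl)
      · rfl
      · exact (hpartner' r).symm
  refine ⟨openArcsSetoid f, ?_, hstep⟩
  have hcount : ∀ r, edgeCount (openArcsSetoid f) (stepEdge (openArcsSetoid f) r) = 2 := by
    intro r
    rw [edgeCount_stepEdge, hstep]
    exact hπ.1 r
  have hedges : 2 * (partitionGraphEdges (openArcsSetoid f)).ncard = n + 1 := by
    refine Eq.trans ?_ (sum_edgeCount (σ := openArcsSetoid f))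
    rw [ncard_partitionGraphEdges, mul_comm, ← smul_eq_mul, ← Finset.sum_const]
    refine Finset.sum_congr rfl fun e he => ?_
    simp only [Finset.mem_image, Finset.mem_univ, true_and] at he
    obtain ⟨r, rfl⟩ := he
    exact (hcount r).symm
  -- distinct edges belong to distinct arcs `a`, each of which is first open at the vertex of `a + 1`
  have hlow : (partitionGraphEdges (openArcsSetoid f)).ncard + 1 ≤
      Nat.card (Quotient (openArcsSetoid f)) := by
    have he : (partitionGraphEdges (openArcsSetoid f)).ncard = Nat.card {a // a < f a} := by
      rw [← Nat.card_coe_set_eq]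
      symm
      refine Nat.card_eq_of_bijective
        (fun a : {a // a < f a} =>
          (⟨stepEdge (openArcsSetoid f) a, a.1, rfl⟩ : partitionGraphEdges (openArcsSetoid f)))
        ⟨?_, ?_⟩
      · rintro ⟨a, ha⟩ ⟨b, hb⟩ h
        exact Subtype.ext (hinj a b ha hb (Subtype.ext_iff.1 h))
      · rintro ⟨_, r, rfl⟩
        obtain ⟨a, ha, rfl | rfl⟩ := hfirst r
        · exact ⟨⟨r, ha⟩, rfl⟩
        · exact ⟨⟨a, ha⟩, Subtype.ext (hpartner' a).symm⟩
    rw [he, ← Finite.card_option]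
    have hself : ∀ a, a < f a → a ∈ openArcs f (a + 1) := fun a ha => by
      rw [openArcs_add_one hinv ha]; exact Set.mem_insert _ _
    refine Nat.card_le_card_of_injective
      (fun o : Option {a // a < f a} => o.elim (Quotient.mk (openArcsSetoid f) 0)
        fun a => Quotient.mk (openArcsSetoid f) (finRotate (n + 1) a)) ?_
    have h0 : ∀ a, a < f a → Quotient.mk (openArcsSetoid f) (finRotate (n + 1) a) ≠
        Quotient.mk (openArcsSetoid f) 0 := by
      intro a ha h
      have h' : openArcs f (finRotate (n + 1) a) = openArcs f (0 : Fin (n + 1)) :=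
        Quotient.exact h
      rw [openArcs_finRotate, Fin.val_zero, openArcs_zero] at h'
      exact absurd (hself a ha) (h' ▸ Set.notMem_empty a)
    rintro (_ | ⟨a, ha⟩) (_ | ⟨b, hb⟩) h
    · rfl
    · exact absurd h.symm (h0 b hb)
    · exact absurd h (h0 a ha)
    · have h' : openArcs f (finRotate (n + 1) a) = openArcs f (finRotate (n + 1) b) :=
        Quotient.exact h
      rw [openArcs_finRotate, openArcs_finRotate] at h'
      have h1 : a ∈ openArcs f (b + 1) := h' ▸ hself a ha
      have h2 : b ∈ openArcs f (a + 1) := h' ▸ hself b hb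
      have : a = b := Fin.ext (by have := h1.2.1; have := h2.2.1; omega)
      subst this
      rfl
  have hup := ncard_vertices_le (σ := openArcsSetoid f)
  exact ⟨partitionGraphIsTree_of_card (le_antisymm hup hlow), by omega⟩

lemma bijOn_stepPairing :
    Set.BijOn stepPairing (treePartitions (n + 1)) (nonCrossingPairings (n + 1)) :=
  ⟨fun _ hσ => stepPairing_mem hσ, injOn_stepPairing, surjOn_stepPairing⟩

end Surjective

/-! ### The trace of a matrix power as a sum over closed walks -/

lemma Matrix.pow_add_one_apply_eq_sum {V R : Type*} [Fintype V] [DecidableEq V] [CommRing R]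
    (A : Matrix V V R) (n : ℕ) : ∀ x y, (A ^ (n + 1)) x y =
      ∑ q : Fin n → V, ∏ r : Fin (n + 1),
        A ((Fin.cons x q : Fin (n + 1) → V) r) ((Fin.snoc q y : Fin (n + 1) → V) r) := by
  induction n with
  | zero =>
    intro x y
    simp [Fin.snoc]
  | succ n ih =>
    intro x y
    rw [pow_succ', Matrix.mul_apply, ← (Fin.consEquiv fun _ => V).sum_comp, Fintype.sum_prod_type]
    refine Finset.sum_congr rfl fun z _ => ?_
    rw [ih, Finset.mul_sum]
    refine Finset.sum_congr rfl fun q _ => ?_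
    rw [Fin.prod_univ_succ (n := n + 1)]
    simp only [Fin.consEquiv, Equiv.coe_fn_mk, ← Fin.cons_snoc_eq_snoc_cons, Fin.cons_zero,
      Fin.cons_succ]

lemma Matrix.trace_pow_add_one_eq_sum {V R : Type*} [Fintype V] [DecidableEq V] [CommRing R]
    (A : Matrix V V R) (n : ℕ) : (A ^ (n + 1)).trace =
      ∑ i : Fin (n + 1) → V, ∏ r, A (i r) (i (finRotate (n + 1) r)) := by
  rw [← (Fin.consEquiv fun _ => V).sum_comp, Fintype.sum_prod_type, Matrix.trace]
  refine Finset.sum_congr rfl fun x _ => ?_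
  rw [Matrix.diag_apply, Matrix.pow_add_one_apply_eq_sum]
  refine Finset.sum_congr rfl fun q _ => Finset.prod_congr rfl fun r _ => ?_
  rw [Fin.snoc_eq_cons_rotate]
  rfl

/-! ### Expectations of products of matrix entries -/

/-- A product of powers of independent random variables with law `μ`. -/
lemma integrable_and_integral_prod_pow {Ω ι : Type*} [MeasurableSpace Ω] {P : Measure Ω}
    {μ : Measure ℝ} (hmom : ∀ k : ℕ, Integrable (fun x : ℝ => x ^ k) μ) {X : ι → Ω → ℝ}
    (hind : iIndepFun X P) (hlaw : ∀ i, HasLaw (X i) μ P) (s : Finset ι) (c : ι → ℕ) :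
    Integrable (∏ z ∈ s, X z ^ c z) P ∧
      ∫ ω, (∏ z ∈ s, X z ^ c z) ω ∂P = ∏ z ∈ s, ∫ x, x ^ c z ∂μ := by
  classical
  have := hind.isProbabilityMeasure
  have hmeas : ∀ z, AEMeasurable (X z ^ c z) P := fun z => (hlaw z).aemeasurable.pow_const _
  have hind' : iIndepFun (fun z => X z ^ c z) P :=
    hind.comp (fun z x => x ^ c z) fun z => measurable_id.pow_const _
  have hint : ∀ z, Integrable (X z ^ c z) P := fun z => by
    have h := hmom (c z)
    rw [← (hlaw z).map_eq] at h
    exact h.comp_aemeasurable (hlaw z).aemeasurable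
  induction s using Finset.induction_on with
  | empty => exact ⟨by rw [Finset.prod_empty]; exact integrable_const (1 : ℝ), by simp⟩
  | insert z s hz ih =>
    have hi : IndepFun (X z ^ c z) (∏ w ∈ s, X w ^ c w) P :=
      (hind'.indepFun_finsetProd_of_notMem₀ hmeas hz).symm
    rw [Finset.prod_insert hz, Finset.prod_insert hz]
    refine ⟨hi.integrable_mul (hint z) ih.1, ?_⟩
    have h1 := hi.integral_mul_eq_mul_integral (hint z).aestronglyMeasurable
      ih.1.aestronglyMeasurable
    rw [h1, ih.2]
    congr 1
    exact (hlaw z).integral_comp (f := fun x => x ^ c z) (hmom _).aestronglyMeasurable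

/-- The expectation of the product of the entries along a closed walk with partition `σ`: the
product over the edges of the moments of `μ` that belong to their multiplicities. -/
noncomputable def walkWeight {m : ℕ} (μ : Measure ℝ) (σ : Setoid (Fin m)) : ℝ :=
  open Classical in ∏ e ∈ Finset.univ.image (stepEdge σ), ∫ x, x ^ edgeCount σ e ∂μ

lemma integrable_and_integral_walk {Ω : Type*} [MeasurableSpace Ω] {P : Measure Ω}
    {μ : Measure ℝ} (hmom : ∀ k : ℕ, Integrable (fun x : ℝ => x ^ k) μ) {N m : ℕ}
    {a : Fin N → Fin N → Ω → ℝ} (hsymm : ∀ i j, a i j = a j i)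
    (hind : iIndepFun (fun p : {p : Fin N × Fin N // p.2 ≤ p.1} => a p.1.1 p.1.2) P)
    (hlaw : ∀ i j, HasLaw (a i j) μ P) (i : Fin m → Fin N) :
    Integrable (fun ω => ∏ r, a (i r) (i (finRotate m r)) ω) P ∧
      ∫ ω, ∏ r, a (i r) (i (finRotate m r)) ω ∂P = walkWeight μ (Setoid.ker i) := by
  classical
  -- symmetry makes the entries a family indexed by unordered pairs
  let b : Sym2 (Fin N) → Ω → ℝ := Sym2.lift ⟨a, hsymm⟩
  have hb : ∀ x y, b s(x, y) = a x y := fun x y => rfl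
  have hbind : iIndepFun b P := by
    let g : Sym2 (Fin N) → {p : Fin N × Fin N // p.2 ≤ p.1} :=
      fun z => ⟨(z.sup, z.inf), z.inf_le_sup⟩
    have hg : Function.Injective g := by
      intro z w h
      simp only [g, Subtype.mk.injEq, Prod.mk.injEq] at h
      exact Sym2.inf_eq_inf_and_sup_eq_sup.1 ⟨h.2, h.1⟩
    convert hind.precomp hg using 1
    funext z
    induction z with | _ x y
    rcases le_total x y with h | h
    · simp [g, hb, h, hsymm x y]
    · simp [g, hb, h]
  have hblaw : ∀ z, HasLaw (b z) μ P := by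
    intro z
    induction z with | _ x y
    exact hlaw x y
  let ι : Quotient (Setoid.ker i) → Fin N := Setoid.kerLift i
  have hι : Function.Injective (Sym2.map ι) := Sym2.map.injective (Setoid.kerLift_injective i)
  let e : Fin m → Sym2 (Fin N) := fun r => s(i r, i (finRotate m r))
  have he : ∀ r, e r = Sym2.map ι (stepEdge (Setoid.ker i) r) := fun r => rfl
  have hprod : (fun ω => ∏ r, a (i r) (i (finRotate m r)) ω) =
      ∏ z ∈ Finset.univ.image e, b z ^ (Finset.univ.filter fun r => e r = z).card := by
    rw [← Finset.prod_comp]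
    funext ω
    simp [e, hb]
  obtain ⟨h1, h2⟩ := integrable_and_integral_prod_pow hmom hbind hblaw (Finset.univ.image e)
    fun z => (Finset.univ.filter fun r => e r = z).card
  rw [← hprod] at h1 h2
  refine ⟨h1, h2.trans ?_⟩
  have himage : Finset.univ.image e =
      (Finset.univ.image (stepEdge (Setoid.ker i))).image (Sym2.map ι) := by
    rw [Finset.image_image]
    rfl
  rw [himage, Finset.prod_image hι.injOn, walkWeight]
  refine Finset.prod_congr rfl fun z _ => ?_
  have : (Finset.univ.filter fun r => e r = Sym2.map ι z).card = edgeCount (Setoid.ker i) z := by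
    rw [edgeCount, ← Set.ncard_coe_finset]
    congr 1
    ext r
    simp [he, hι.eq_iff]
  rw [this]

/-- The index functions with a given partition are the injections of its blocks. -/
def kerEqEquivEmbedding {α β : Type*} (σ : Setoid α) :
    {i : α → β // Setoid.ker i = σ} ≃ (Quotient σ ↪ β) where
  toFun i := ⟨Quotient.lift i.1 fun x y h => by
      have h' : Setoid.ker i.1 x y := i.2.symm ▸ h
      exact h', by
    rintro ⟨x⟩ ⟨y⟩ h
    have h' : Setoid.ker i.1 x y := h
    rw [i.2] at h'
    exact Quotient.sound h'⟩
  invFun f := ⟨fun x => f (Quotient.mk σ x), by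
    ext x y
    rw [Setoid.ker_def, f.injective.eq_iff, Quotient.eq]⟩
  left_inv _ := rfl
  right_inv f := by
    ext x
    induction x using Quotient.ind
    rfl

instance Setoid.instFinite {α : Type*} [Finite α] : Finite (Setoid α) :=
  Finite.of_injective (fun σ : Setoid α => fun x y => σ x y) fun σ τ h => by
    ext x y
    exact iff_of_eq (congrFun (congrFun h x) y)

lemma sum_fun_ker {m N : ℕ} [Fintype (Setoid (Fin m))] (F : Setoid (Fin m) → ℝ) :
    ∑ i : Fin m → Fin N, F (Setoid.ker i) =
      ∑ σ, (N.descFactorial (Nat.card (Quotient σ)) : ℝ) * F σ := by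
  classical
  rw [← Finset.sum_fiberwise Finset.univ (fun i : Fin m → Fin N => Setoid.ker i)]
  refine Finset.sum_congr rfl fun σ _ => ?_
  have : Fintype (Quotient σ) := Fintype.ofFinite _
  rw [Finset.sum_congr rfl (g := fun _ => F σ) fun i hi => by rw [(Finset.mem_filter.1 hi).2],
    Finset.sum_const, nsmul_eq_mul, ← Fintype.card_subtype,
    Fintype.card_congr (kerEqEquivEmbedding σ), Fintype.card_embedding_eq, Fintype.card_fin,
    Nat.card_eq_fintype_card]

/-- The expected trace, sorted by the partition of `[m]` that records which indices of a closed walk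
coincide: the weight depends on this partition only, and a partition with `k` blocks comes from
`N (N - 1) ⋯ (N - k + 1)` index functions. -/
lemma integrable_and_integral_normTrace_pow {Ω : Type*} [MeasurableSpace Ω] {P : Measure Ω}
    {μ : Measure ℝ} (hmom : ∀ k : ℕ, Integrable (fun x : ℝ => x ^ k) μ) {N n : ℕ}
    {A : Ω → Matrix (Fin N) (Fin N) ℝ} (hA : IsWignerMatrix P μ A)
    [Fintype (Setoid (Fin (n + 1)))] :
    Integrable (fun ω => normTrace (A ω ^ (n + 1))) P ∧
      ∫ ω, normTrace (A ω ^ (n + 1)) ∂P =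
        ∑ σ : Setoid (Fin (n + 1)), (N.descFactorial (Nat.card (Quotient σ)) : ℝ) *
          (1 / (N : ℝ) * (1 / √(N : ℝ)) ^ (n + 1) * walkWeight μ σ) := by
  obtain ⟨a, hsymm, hind, hlaw, hAa⟩ := hA
  have h := fun i : Fin (n + 1) → Fin N => integrable_and_integral_walk hmom hsymm hind hlaw i
  have hexp : (fun ω => normTrace (A ω ^ (n + 1))) = fun ω => ∑ i : Fin (n + 1) → Fin N,
      1 / (N : ℝ) * (1 / √(N : ℝ)) ^ (n + 1) *
        ∏ r, a (i r) (i (finRotate (n + 1) r)) ω := by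
    funext ω
    rw [normTrace, Matrix.trace_pow_add_one_eq_sum, Finset.mul_sum]
    refine Finset.sum_congr rfl fun i _ => ?_
    simp only [hAa, Finset.prod_mul_distrib, Finset.prod_const, Finset.card_univ,
      Fintype.card_fin, mul_assoc]
  rw [hexp]
  refine ⟨integrable_finsetSum _ fun i _ => (h i).1.const_mul _, ?_⟩
  rw [integral_finsetSum _ fun i _ => (h i).1.const_mul _]
  simp only [integral_const_mul, (h _).2]
  exact sum_fun_ker fun σ => 1 / (N : ℝ) * (1 / √(N : ℝ)) ^ (n + 1) * walkWeight μ σ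

/-! ### The limit -/

section Weight

variable {n : ℕ} {μ : Measure ℝ} {σ : Setoid (Fin (n + 1))}

/-- As `μ` is centered, the weight vanishes if some edge is used exactly once. -/
lemma two_le_edgeCount_of_walkWeight_ne_zero (hmean : ∫ x, x ∂μ = 0) (hσ : walkWeight μ σ ≠ 0)
    (r : Fin (n + 1)) : 2 ≤ edgeCount σ (stepEdge σ r) := by
  classical
  have h1 : edgeCount σ (stepEdge σ r) ≠ 0 := by
    exact Set.ncard_ne_zero_of_mem (a := r) rfl
  have h2 : edgeCount σ (stepEdge σ r) ≠ 1 := by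
    intro h
    rw [walkWeight, Finset.prod_ne_zero_iff] at hσ
    refine hσ (stepEdge σ r) (Finset.mem_image_of_mem _ (Finset.mem_univ r)) ?_
    rw [h]
    simpa using hmean
  omega

lemma walkWeight_of_mem_treePartitions (hsecond : ∫ x, x ^ 2 ∂μ = 1)
    (hσ : σ ∈ treePartitions (n + 1)) : walkWeight μ σ = 1 := by
  classical
  rw [walkWeight]
  refine Finset.prod_eq_one fun e he => ?_
  simp only [Finset.mem_image, Finset.mem_univ, true_and] at he
  obtain ⟨r, rfl⟩ := he
  rw [edgeCount_of_mem_treePartitions hσ, hsecond]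

/-- Contributing partitions have at most `m / 2 + 1` blocks, the order that the normalization
sustains. -/
lemma two_mul_card_le_of_walkWeight_ne_zero (hmean : ∫ x, x ∂μ = 0) (hσ : walkWeight μ σ ≠ 0) :
    2 * Nat.card (Quotient σ) ≤ n + 1 + 2 := by
  have h1 := two_mul_ncard_edges_le (two_le_edgeCount_of_walkWeight_ne_zero hmean hσ)
  have h2 := ncard_vertices_le (σ := σ)
  omega

lemma mem_treePartitions_of_walkWeight_ne_zero (hmean : ∫ x, x ∂μ = 0) (hσ : walkWeight μ σ ≠ 0)
    (hc : 2 * Nat.card (Quotient σ) = n + 1 + 2) : σ ∈ treePartitions (n + 1) := by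
  have h1 := two_mul_ncard_edges_le (two_le_edgeCount_of_walkWeight_ne_zero hmean hσ)
  have h2 := ncard_vertices_le (σ := σ)
  exact ⟨partitionGraphIsTree_of_card (by omega), hc⟩

/-- The number of index functions with `k` distinct values, in the scaling of the expected trace. -/
lemma tendsto_descFactorial_scaled (m k : ℕ) (h : 2 * k ≤ m + 2) :
    Tendsto (fun N : ℕ => (N.descFactorial k : ℝ) * (1 / (N : ℝ) * (1 / √(N : ℝ)) ^ m)) atTop
      (𝓝 (if 2 * k = m + 2 then 1 else 0)) := by
  obtain ⟨d, hd⟩ := Nat.exists_eq_add_of_le h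
  have h1 : Tendsto (fun N : ℕ => (N.descFactorial k : ℝ) / (N : ℝ) ^ k) atTop (𝓝 1) := by
    have := isEquivalent_descFactorial k
    rwa [Asymptotics.isEquivalent_iff_tendsto_one] at this
    filter_upwards [eventually_ge_atTop 1] with N hN
    positivity
  have h2 : Tendsto (fun N : ℕ => (1 / √(N : ℝ)) ^ d) atTop
      (𝓝 (if 2 * k = m + 2 then 1 else 0)) := by
    split_ifs with hk
    · have : d = 0 := by omega
      subst this
      simp
    · have h3 : Tendsto (fun N : ℕ => 1 / √(N : ℝ)) atTop (𝓝 0) := by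
        simp only [one_div]
        exact tendsto_inv_atTop_zero.comp
          (Real.tendsto_sqrt_atTop.comp tendsto_natCast_atTop_atTop)
      have := h3.pow d
      rwa [zero_pow (by omega)] at this
  have h3 := h1.mul h2
  rw [one_mul] at h3
  refine h3.congr' ?_
  filter_upwards [eventually_ge_atTop 1] with N hN
  have hN' : (0 : ℝ) < N := by exact_mod_cast hN
  have hx := Real.sqrt_pos.2 hN'
  have hxx : (N : ℝ) = √(N : ℝ) ^ 2 := (Real.sq_sqrt hN'.le).symm
  have key : (N : ℝ) ^ k * √(N : ℝ) ^ d = (N : ℝ) * √(N : ℝ) ^ m := by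
    generalize √(N : ℝ) = x at *
    rw [hxx, ← pow_mul, ← pow_add, ← pow_add]
    congr 1
    omega
  rw [one_div_pow, one_div_pow, div_mul_div_comm, key, mul_one, one_div_mul_one_div, mul_one_div]

/-- Only tree partitions contribute to the limit. -/
lemma tendsto_summand (hmean : ∫ x, x ∂μ = 0) (hsecond : ∫ x, x ^ 2 ∂μ = 1)
    [Decidable (σ ∈ treePartitions (n + 1))] :
    Tendsto (fun N : ℕ => (N.descFactorial (Nat.card (Quotient σ)) : ℝ) *
        (1 / (N : ℝ) * (1 / √(N : ℝ)) ^ (n + 1) * walkWeight μ σ)) atTop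
      (𝓝 (if σ ∈ treePartitions (n + 1) then 1 else 0)) := by
  by_cases hw : walkWeight μ σ = 0
  · have hσ : σ ∉ treePartitions (n + 1) := fun h => by
      rw [walkWeight_of_mem_treePartitions hsecond h] at hw
      exact one_ne_zero hw
    simp [hw, hσ]
  · have h := (tendsto_descFactorial_scaled (n + 1) _
      (two_mul_card_le_of_walkWeight_ne_zero hmean hw)).mul_const (walkWeight μ σ)
    simp only [mul_assoc] at h ⊢
    convert h using 2
    by_cases hc : 2 * Nat.card (Quotient σ) = n + 1 + 2
    · have hσ := mem_treePartitions_of_walkWeight_ne_zero hmean hw hc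
      rw [if_pos hσ, if_pos hc, walkWeight_of_mem_treePartitions hsecond hσ, one_mul]
    · rw [if_neg hc, if_neg fun hσ => hc hσ.2, zero_mul]

end Weight

theorem theorem3p9
    (μ : Measure ℝ) [IsProbabilityMeasure μ]
    (hmom : ∀ k : ℕ, Integrable (fun x : ℝ => x ^ k) μ)
    (hmean : ∫ x, x ∂μ = 0)
    (hsecond : ∫ x, x ^ 2 ∂μ = 1)
    {Ω : ℕ → Type*} [∀ N, MeasurableSpace (Ω N)]
    (P : ∀ N, Measure (Ω N)) [∀ N, IsProbabilityMeasure (P N)]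
    (A : ∀ N, Ω N → Matrix (Fin N) (Fin N) ℝ)
    (hA : ∀ N, IsWignerMatrix (P N) μ (A N)) (m : ℕ) :
    (∀ N, Integrable (fun ω => normTrace (A N ω ^ m)) (P N)) ∧
    Tendsto (fun N => ∫ ω, normTrace (A N ω ^ m) ∂(P N)) atTop
      (𝓝 (1 / (2 * Real.pi) * ∫ x in (-2 : ℝ)..2, x ^ m * √(4 - x ^ 2))) ∧
    (1 ≤ m →
      Tendsto (fun N => ∫ ω, normTrace (A N ω ^ m) ∂(P N)) atTop
        (𝓝 ((treePartitions m).ncard : ℝ)) ∧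
      Set.BijOn stepPairing (treePartitions m) (nonCrossingPairings m)) := by
  classical
  rw [semicircle_moment]
  cases m with
  | zero =>
    simp only [pow_zero]
    refine ⟨fun N => integrable_const _, ?_, fun h => absurd h (by omega)⟩
    refine tendsto_const_nhds.congr' ?_
    -- the normalized trace of the identity is `1` except for `N = 0`, where it is `0`
    filter_upwards [eventually_ge_atTop 1] with N hN
    have hN' : (N : ℝ) ≠ 0 := by positivity
    simp [normTrace, aeratedCatalan, hN']
  | succ n =>
    have : Fintype (Setoid (Fin (n + 1))) := Fintype.ofFinite _
    have hlim : Tendsto (fun N => ∫ ω, normTrace (A N ω ^ (n + 1)) ∂(P N)) atTop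
        (𝓝 ((treePartitions (n + 1)).ncard : ℝ)) := by
      simp only [(integrable_and_integral_normTrace_pow hmom (hA _)).2]
      have hcard : ((treePartitions (n + 1)).ncard : ℝ) =
          ∑ σ : Setoid (Fin (n + 1)), if σ ∈ treePartitions (n + 1) then 1 else 0 := by
        rw [Finset.sum_boole, ← Set.ncard_coe_finset]
        simp
      rw [hcard]
      exact tendsto_finsetSum _ fun σ _ => tendsto_summand hmean hsecond
    refine ⟨fun N => (integrable_and_integral_normTrace_pow hmom (hA N)).1, ?_,
      fun _ => ⟨hlim, bijOn_stepPairing⟩⟩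
    rw [← ncard_nonCrossingPairings, ← bijOn_stepPairing.image_eq,
      injOn_stepPairing.ncard_image]
    exact hlim
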